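/- Fix a field $\mathbf k$ and integers $1\le r\le d$. Simplicial complexes are finite and contain the empty face. For a simplicial complex $\Delta$ of dimension $d-1$: - $\Delta$ is a *homology $(d-1)$-sphere* (over $\mathbf k$) if $\widetilde H_*(\mathrm{lk}_\Delta(F);\mathbf k)\cong\widetilde H_*(\mathbb S^{d-|F|-1};\mathbf k)$ for every face $F$ (including $\emptyset$); it is a *closed homology $(d-1)$-manifold* if this holds for every nonempty face. - $\Delta$ is *balanced* if it is equipped with a vertex colouring $\kappa$ by $[d]=\{1,\dots,d\}$ such that no face contains two vertices of the same colour. - For $S\subseteq[d]$ (or for a larger colour set), $f_S(\Delta)$ is the number of faces $F\in\Delta$ with $\kappa(F)=S$, and $h_T(\Delta)=\sum_{S\subseteq T}(-1)^{|T|-|S|}f_S(\Delta)$. A *$d$-dimensional cross-polytopal complex* is a (finite) $d$-dimensional regular CW complex $\mathcal X$ whose $(d-1)$-skeleton is a simplicial complex, such that the boundary of each $d$-cell is (a copy of) the boundary complex of the $d$-dimensional cross-polytope, i.e. the complex with $2d$ distinct vertices $u_1,v_1,\dots,u_d,v_d$ whose faces are all vertex sets containing no pair $\{u_i,v_i\}$,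 and such that no two $d$-cells have the same vertex set. If $\mathcal Y$ is such a complex or a $d$-dimensional simplicial complex, its *boundary complex* $\partial\mathcal Y$ consists of $\emptyset$ and all nonempty faces $F$ with $H_*(\|\mathcal Y\|,\|\mathcal Y\|-p;\mathbf k)=0$ for $p$ in the relative interior of $F$. $\mathcal X$ is a *homology $d$-ball* if for every $p\in\|\mathcal X\|$ the pair $(\|\mathcal X\|,\|\mathcal X\|-p)$ has, over $\mathbf k$, either vanishing relative homology or that of a $d$-sphere (one copy of $\mathbf k$, in degree $d$), if $\widetilde H_*(\|\mathcal X\|;\mathbf k)=0$, and if $\partial\mathcal X$ is a homology $(d-1)$-sphere. Let $\Delta$ be a balanced homology $(d-1)$-sphere over $\mathbf k$, and let $\mathcal X$ be an *$(r-1)$-stacked cross-polytopal decomposition* of $\Delta$, that is, a $d$-dimensional cross-polytopal complex that is a homology $d$-ball over $\mathbf k$ with $\partial\mathcal X=\Delta$ and all of whose faces of dimension at most $d-r$ are faces of $\Delta$. Let $m$ be the number of $d$-cells $C_1,\dots,C_m$ of $\mathcal X$, and let $\Gamma$ be the simplicial complex obtained from $\mathcal X$ by replacing each $C_i$ by the cone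 over its boundary with a new apex $b_i$; colour the vertices of $\Gamma$ by giving those of $\Delta$ their colours and all the $b_i$ the new colour $d+1$. **Theorem.** For every $T\subseteq[d]$ with $r-1\le|T|\le d-r+1$, $$h_T(\Delta)=h_T(\partial\Gamma)=m .$$ -/

import Mathlib

open Finset

universe u v

/-- A finite abstract simplicial complex with vertices in `V`; the empty set is a face. -/
@[ext]
structure FinComplex (V : Type u) where
  faces : Finset (Finset V)
  empty_mem : ∅ ∈ faces
  down_closed : ∀ F ∈ faces, ∀ G, G ⊆ F → G ∈ faces

section Homology

variable {V : Type u}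

/-- The coefficient of `G` in the boundary of the simplex `F`, each simplex being oriented by a fixed
well-order of the type of all vertices: it is `(-1)^j` if `G` arises from `F` by deleting the vertex
that has exactly `j` predecessors in `F`, and it is `0` if `G` is not of this form. -/
noncomputable def incidence (F G : Finset V) : ℤ := by
  classical
  exact ∑ v ∈ F, if F.erase v = G then (-1) ^ #{w ∈ F | WellOrderingRel w v} else 0

/-- The members of cardinality `n`, that is, of dimension `n - 1`, of a family of faces. -/
def facesOfCard (A : Finset (Finset V)) (n : ℕ) : Finset (Finset V) := {F ∈ A | #F = n}

/-- The simplicial boundary map from chains on the faces in `A` with `n + 1` vertices to chains on the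
faces in `A` with `n` vertices. -/
noncomputable def boundaryMap (k : Type v) [Field k] (A : Finset (Finset V)) (n : ℕ) :
    (facesOfCard A (n + 1) → k) →ₗ[k] (facesOfCard A n → k) :=
  Matrix.mulVecLin (Matrix.of fun G F => ((incidence F.1 G.1 : ℤ) : k))

/-- Cycles on the faces in `A` with `n` vertices. -/
noncomputable def cycles (k : Type v) [Field k] (A : Finset (Finset V)) :
    (n : ℕ) → Submodule k (facesOfCard A n → k)
  | 0 => ⊤
  | n + 1 => LinearMap.ker (boundaryMap k A n)

/-- Simplicial homology in dimension `n - 1` with coefficients in `k` of the chain complex spanned by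
a family `A` of faces. If `A` is the set of all faces (with the empty one) of a simplicial complex, this
is its reduced homology; if `A = K \ L` for a complex `K` and a subcomplex `L` with `∅ ∈ L`, it is the
relative homology of the pair `(K, L)`. -/
abbrev Homology (k : Type v) [Field k] (A : Finset (Finset V)) (n : ℕ) : Type (max u v) :=
  cycles k A n ⧸ (LinearMap.range (boundaryMap k A n)).submoduleOf (cycles k A n)

/-- All the homology of `A` vanishes. -/
def IsAcyclic (k : Type v) [Field k] (A : Finset (Finset V)) : Prop :=
  ∀ n, Module.finrank k (Homology k A n) = 0

/-- The homology of `A` is one-dimensional in dimension `s - 1` and vanishes in all others. -/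
def HasSphereHomology (k : Type v) [Field k] (A : Finset (Finset V)) (s : ℕ) : Prop :=
  ∀ n, Module.finrank k (Homology k A n) = if n = s then 1 else 0

end Homology

namespace FinComplex

variable {V : Type u}

/-- `K` has dimension `d - 1`. -/
def HasDimPred (K : FinComplex V) (d : ℕ) : Prop :=
  (∃ F ∈ K.faces, #F = d) ∧ ∀ F ∈ K.faces, #F ≤ d

/-- The vertex set of `K`. -/
def vertices (K : FinComplex V) : Set V := {x | {x} ∈ K.faces}

/-- The faces of the link of `F` in `K`. -/
noncomputable def link (K : FinComplex V) (F : Finset V) : Finset (Finset V) := by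
  classical
  exact {G ∈ K.faces | Disjoint F G ∧ F ∪ G ∈ K.faces}

/-- The faces of `K` that contain `F`, i.e. those of `K` that are not in the subcomplex of all faces not
containing `F`. For `F` nonempty and `p` in the relative interior of `F`, the realization of this
subcomplex is a deformation retract of `‖K‖ - p`, so that the homology of this family of faces is
`H_*(‖K‖, ‖K‖ - p)`. -/
noncomputable def openStar (K : FinComplex V) (F : Finset V) : Finset (Finset V) := by
  classical
  exact {G ∈ K.faces | F ⊆ G}

/-- `K` is a homology `(d-1)`-sphere over `k`. -/
def IsHomologySphere (k : Type v) [Field k] (K : FinComplex V) (d : ℕ) : Prop :=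
  K.HasDimPred d ∧ ∀ F ∈ K.faces, HasSphereHomology k (K.link F) (d - #F)

/-- `K` is a closed homology `(d-1)`-manifold over `k`. -/
def IsClosedHomologyManifold (k : Type v) [Field k] (K : FinComplex V) (d : ℕ) : Prop :=
  K.HasDimPred d ∧ ∀ F ∈ K.faces, F ≠ ∅ → HasSphereHomology k (K.link F) (d - #F)

/-- The boundary complex of `K`: the empty face and all nonempty faces `F` such that
`H_*(‖K‖, ‖K‖ - p; k) = 0` for `p` in the relative interior of `F`. -/
noncomputable def boundaryFaces (k : Type v) [Field k] (K : FinComplex V) : Finset (Finset V) := by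
  classical
  exact {F ∈ K.faces | F = ∅ ∨ IsAcyclic k (K.openStar F)}

/-- `K` is a `(d-1)`-dimensional complex, and `κ` is a proper colouring of it with `d` colours. -/
def IsBalanced {d : ℕ} (K : FinComplex V) (κ : V → Fin d) : Prop :=
  K.HasDimPred d ∧ ∀ F ∈ K.faces, Set.InjOn κ F

/-- `K` is a copy in `V` of the boundary complex of the `d`-dimensional cross-polytope: its vertices are
the `2 d` distinct points `φ (i, true)`, `φ (i, false)`, and its faces are all sets of vertices that do
not contain an antipodal pair. -/
def IsCrossPolytope (K : FinComplex V) (d : ℕ) : Prop :=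
  ∃ φ : Fin d × Bool ↪ V, ∀ F : Finset V, F ∈ K.faces ↔
    ∃ G : Finset (Fin d × Bool), (∀ i, ¬((i, true) ∈ G ∧ (i, false) ∈ G)) ∧ G.map φ = F

end FinComplex

/-- The flag `f`-number: the number of faces in `A` whose set of colours is `S`. -/
def flagF {V : Type u} {d : ℕ} (A : Finset (Finset V)) (κ : V → Fin d) (S : Finset (Fin d)) : ℕ :=
  #{F ∈ A | F.image κ = S}

/-- The flag `h`-number `h_T = ∑_{S ⊆ T} (-1)^(|T| - |S|) f_S`. -/
def flagH {V : Type u} {d : ℕ} (A : Finset (Finset V)) (κ : V → Fin d) (T : Finset (Fin d)) : ℤ :=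
  ∑ S ∈ T.powerset, (-1) ^ (#T - #S) * (flagF A κ S : ℤ)

/-- A `d`-dimensional cross-polytopal complex: a regular CW complex whose `(d-1)`-skeleton is a
simplicial complex `skel`, such that the boundary of each `d`-cell is a subcomplex of `skel` isomorphic
to the boundary of the cross-polytope, and no two `d`-cells have the same vertex set. A `d`-cell is
recorded by its boundary complex, which determines it. -/
structure CrossPolytopalComplex (V : Type u) (d : ℕ) where
  skel : FinComplex V
  skel_dim : ∀ F ∈ skel.faces, #F ≤ d
  cells : Finset (FinComplex V)
  cells_nonempty : cells.Nonempty
  cell_subset : ∀ C ∈ cells, C.faces ⊆ skel.faces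
  cell_crossPolytope : ∀ C ∈ cells, C.IsCrossPolytope d
  cell_eq : ∀ C ∈ cells, ∀ C' ∈ cells, C.vertices = C'.vertices → C = C'

namespace CrossPolytopalComplex

variable {V : Type u} {d : ℕ}

/-- A simplicial face of `X`, regarded as a face of the stellar subdivision. -/
def oldFace (X : CrossPolytopalComplex V d) (F : Finset V) : Finset (V ⊕ X.cells) :=
  F.map Function.Embedding.inl

/-- The cone over the boundary face `F` of the `d`-cell `C`, with the new vertex of `C` as its apex. -/
def coneFace (X : CrossPolytopalComplex V d) (C : X.cells) (F : Finset V) : Finset (V ⊕ X.cells) :=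
  Finset.cons (Sum.inr C) (X.oldFace F) (by simp [oldFace])

/-- The stellar subdivision `Γ` of `X`: each `d`-cell `C` is replaced by the cone over its boundary,
with a new vertex as apex. -/
noncomputable def stellar (X : CrossPolytopalComplex V d) : FinComplex (V ⊕ X.cells) where
  faces := by
    classical
    exact X.skel.faces.image X.oldFace ∪
      Finset.univ.biUnion fun C : X.cells => C.1.faces.image (X.coneFace C)
  empty_mem := by
    classical
    exact mem_union_left _ (mem_image.2 ⟨∅, X.skel.empty_mem, by simp [oldFace]⟩)
  down_closed := by
    classical
    intro F hF G hGF
    have key : ∀ G : Finset (V ⊕ X.cells), (∀ C, Sum.inr C ∉ G) → G = X.oldFace G.toLeft := by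
      intro G hG
      ext (x | x) <;> simp [oldFace, hG]
    simp only [mem_union, mem_image, mem_biUnion, mem_univ, true_and] at hF ⊢
    rcases hF with ⟨F, hF, rfl⟩ | ⟨C, F, hF, rfl⟩
    · refine Or.inl ⟨G.toLeft, X.skel.down_closed F hF _ ?_, (key G ?_).symm⟩
      · intro x hx
        have := hGF (mem_toLeft.1 hx)
        simpa [oldFace] using this
      · intro C hC
        have := hGF hC
        simp [oldFace] at this
    · have hsub : G.toLeft ⊆ F := by
        intro x hx
        have := hGF (mem_toLeft.1 hx)
        simpa [oldFace, coneFace] using this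
      have hr : ∀ C', Sum.inr C' ∈ G → C' = C := by
        intro C' hC'
        have := hGF hC'
        simpa [oldFace, coneFace] using this
      by_cases hC : Sum.inr C ∈ G
      · refine Or.inr ⟨C, G.toLeft, C.1.down_closed F hF _ hsub, ?_⟩
        ext (x | x)
        · simp [oldFace, coneFace]
        · simp only [coneFace, oldFace, mem_cons, mem_map, Sum.inr.injEq]
          constructor
          · rintro (rfl | ⟨y, -, hy⟩)
            · exact hC
            · simp at hy
          · exact fun h => Or.inl (hr x h)
      · refine Or.inl ⟨G.toLeft, X.skel.down_closed F (X.cell_subset C.1 C.2 hF) _ hsub,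
          (key G ?_).symm⟩
        intro C' hC'
        exact hC (hr C' hC' ▸ hC')

/-- The boundary complex of `X`: the empty face and all nonempty faces `F` with
`H_*(‖X‖, ‖X‖ - p; k) = 0` for `p` in the relative interior of `F`, the space `‖X‖` being triangulated
by the stellar subdivision. Points inside the `d`-cells have neighbourhoods that are open `d`-balls, so
only faces of the simplicial skeleton can occur. -/
noncomputable def boundaryFaces (k : Type v) [Field k] (X : CrossPolytopalComplex V d) :
    Finset (Finset V) := by
  classical
  exact {F ∈ X.skel.faces | F = ∅ ∨ IsAcyclic k (X.stellar.openStar (X.oldFace F))}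

/-- `X` is a `k`-homology `d`-manifold with boundary. Each point `p` of `‖X‖` lies in the relative
interior of a unique nonempty face `F` of the stellar subdivision, which triangulates `‖X‖`; the pair
`(‖X‖, ‖X‖ - p)` has to have the relative homology of a ball (none) or of a `d`-sphere. -/
def IsHomologyManifoldWithBoundary (k : Type v) [Field k] (X : CrossPolytopalComplex V d) : Prop :=
  (∀ F ∈ X.stellar.faces, F ≠ ∅ →
    IsAcyclic k (X.stellar.openStar F) ∨ HasSphereHomology k (X.stellar.openStar F) (d + 1)) ∧
  ∃ B : FinComplex V, B.faces = X.boundaryFaces k ∧ B.IsClosedHomologyManifold k d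

/-- `X` is a `k`-homology `d`-ball. -/
def IsHomologyBall (k : Type v) [Field k] (X : CrossPolytopalComplex V d) : Prop :=
  X.IsHomologyManifoldWithBoundary k ∧
  IsAcyclic k X.stellar.faces ∧
  ∃ B : FinComplex V, B.faces = X.boundaryFaces k ∧ B.IsHomologySphere k d

/-- `X` is an `(r-1)`-stacked cross-polytopal decomposition of the complex `Δ`: a homology `d`-ball with
boundary complex `Δ`, all of whose faces of dimension at most `d - r` are faces of `Δ`. -/
def IsStackedDecomposition (k : Type v) [Field k] (X : CrossPolytopalComplex V d)
    (Δ : FinComplex V) (r : ℕ) : Prop :=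
  X.IsHomologyBall k ∧ X.boundaryFaces k = Δ.faces ∧
  ∀ F ∈ X.skel.faces, #F ≤ d - r + 1 → F ∈ Δ.faces

/-- The colouring of the stellar subdivision that extends `κ` and gives all new vertices the extra last
colour. -/
def stellarColoring (X : CrossPolytopalComplex V d) (κ : V → Fin d) : V ⊕ X.cells → Fin (d + 1) :=
  Sum.elim (fun x => (κ x).castSucc) (fun _ => Fin.last d)

end CrossPolytopalComplex

/-!
The homological hypotheses enter only through the Euler characteristics of the open stars in the
stellar subdivision `Γ`, which they determine by the Euler–Poincaré formula. For a function `f` on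
the faces of the skeleton of `X`, computing `∑ F, f F * χ(star F)` in two ways expresses
`∑ G, (-1) ^ #G * ∑ F ⊆ G, f F` through the sums of `f` over the cells, the skeleton and `Δ`. Take
for `f F` the sign `(-1) ^ #F` if all colours of `F` lie outside `T`, and `0` otherwise. All faces
with colours in `T` or in its complement are small, hence lie in `Δ`, and what remains is that
`h_T(Δ)` is the sum of the numbers `h_T` of the cells. Each of these is `1`, because a proper
colouring of a cross-polytope gives antipodal vertices the same colour.

This argument needs the colouring to be proper on every face of the skeleton. It is, unless `X` is a
quadrangulated polygon whose interior edges may be monochromatic (`d = r = 2`). In that case the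
boundary has `2 * m + 2` vertices, and the Dehn–Sommerville relations say that the two numbers `h_T`
with `#T = 1` are equal.
-/

section EulerPoincare

variable {V : Type u} {A : Finset (Finset V)}

open scoped Classical in
/-- The sign with which the face opposite to the vertex `x` enters the boundary of the simplex
`F`. -/
noncomputable def vertexSign (F : Finset V) (x : V) : ℤ := (-1) ^ #{w ∈ F | WellOrderingRel w x}

open scoped Classical in
theorem vertexSign_erase {F : Finset V} {x : V} (hx : x ∈ F) (y : V) :
    vertexSign (F.erase x) y =
      if WellOrderingRel x y then -vertexSign F y else vertexSign F y := by
  unfold vertexSign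
  rw [filter_erase]
  split_ifs with h
  · rw [← card_erase_add_one (mem_filter.2 ⟨hx, h⟩), pow_succ, mul_neg_one, neg_neg]
  · rw [erase_eq_of_notMem (by simp [h])]

open scoped Classical in
theorem vertexSign_mul_vertexSign_erase_add_swap {F : Finset V} {x y : V} (hx : x ∈ F) (hy : y ∈ F)
    (hxy : x ≠ y) :
    vertexSign F x * vertexSign (F.erase x) y + vertexSign F y * vertexSign (F.erase y) x = 0 := by
  rw [vertexSign_erase hx, vertexSign_erase hy]
  rcases trichotomous_of (WellOrderingRel (α := V)) x y with h | h | h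
  · rw [if_pos h, if_neg (asymm h)]
    ring
  · exact absurd h hxy
  · rw [if_neg (asymm h), if_pos h]
    ring

open scoped Classical in
theorem incidence_erase {F : Finset V} {x : V} (hx : x ∈ F) :
    incidence F (F.erase x) = vertexSign F x := by
  rw [incidence, sum_eq_single_of_mem x hx, if_pos rfl, vertexSign]
  exact fun y hy hyx => if_neg fun h => hyx (erase_injOn F hy hx h)

open scoped Classical in
theorem exists_erase_eq_of_incidence_ne_zero {F G : Finset V} (h : incidence F G ≠ 0) :
    ∃ x ∈ F, F.erase x = G := by
  obtain ⟨x, hx, hne⟩ := exists_ne_zero_of_sum_ne_zero h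
  exact ⟨x, hx, (ite_ne_right_iff.1 hne).1⟩

open scoped Classical in
theorem exists_erase_eq_of_incidence_mul_incidence_ne_zero {F G H : Finset V}
    (h : incidence F G * incidence G H ≠ 0) : ∃ x ∈ F, x ∉ H ∧ F.erase x = G ∧ H ⊆ F := by
  obtain ⟨x, hx, rfl⟩ := exists_erase_eq_of_incidence_ne_zero (left_ne_zero_of_mul h)
  obtain ⟨y, -, rfl⟩ := exists_erase_eq_of_incidence_ne_zero (right_ne_zero_of_mul h)
  exact ⟨x, hx, by simp, rfl, (erase_subset _ _).trans (erase_subset _ _)⟩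

theorem mem_facesOfCard {n : ℕ} {F : Finset V} : F ∈ facesOfCard A n ↔ F ∈ A ∧ #F = n :=
  mem_filter

/-- Only the two sets strictly between `H` and `F` contribute, and their contributions cancel. -/
theorem sum_incidence_mul_incidence (hA : (A : Set (Finset V)).OrdConnected) {n : ℕ}
    {F H : Finset V} (hF : F ∈ facesOfCard A (n + 2)) (hH : H ∈ facesOfCard A n) :
    ∑ G ∈ facesOfCard A (n + 1), incidence F G * incidence G H = 0 := by
  classical
  rw [mem_facesOfCard] at hF hH
  by_cases hHF : H ⊆ F
  · obtain ⟨x, y, hxy, hFH⟩ : ∃ x y, x ≠ y ∧ F \ H = {x, y} := by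
      rw [← card_eq_two, card_sdiff_of_subset hHF]
      omega
    have mem_sdiff_iff : ∀ z, z ∈ F ∧ z ∉ H ↔ z = x ∨ z = y := fun z => by
      rw [← mem_sdiff, hFH, mem_insert, mem_singleton]
    obtain ⟨hx, hxH⟩ := (mem_sdiff_iff x).2 (Or.inl rfl)
    obtain ⟨hy, hyH⟩ := (mem_sdiff_iff y).2 (Or.inr rfl)
    have erase_mem : ∀ z ∈ F, z ∉ H → F.erase z ∈ facesOfCard A (n + 1) := fun z hz hzH =>
      mem_facesOfCard.2 ⟨hA.out hH.1 hF.1 ⟨subset_erase.2 ⟨hHF, hzH⟩, erase_subset _ _⟩,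
        by rw [card_erase_of_mem hz, hF.2, Nat.add_succ_sub_one]⟩
    have hHyx : H = (F.erase y).erase x := by
      rw [← Finset.sdiff_sdiff_eq_self hHF, hFH]
      grind
    have hHxy : H = (F.erase x).erase y := hHyx.trans erase_right_comm
    rw [← sum_subset (s₁ := {F.erase x, F.erase y}), sum_pair fun h => hxy (erase_injOn F hx hy h),
      incidence_erase hx, incidence_erase hy]
    · nth_rw 1 [hHxy]
      rw [hHyx, incidence_erase (mem_erase.2 ⟨hxy.symm, hy⟩),
        incidence_erase (mem_erase.2 ⟨hxy, hx⟩), vertexSign_mul_vertexSign_erase_add_swap hx hy hxy]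
    · rw [insert_subset_iff, singleton_subset_iff]
      exact ⟨erase_mem x hx hxH, erase_mem y hy hyH⟩
    · intro G _ hG
      contrapose! hG
      obtain ⟨z, hz, hzH, rfl, -⟩ := exists_erase_eq_of_incidence_mul_incidence_ne_zero hG
      rcases (mem_sdiff_iff z).1 ⟨hz, hzH⟩ with rfl | rfl <;> simp
  · refine sum_eq_zero fun G _ => ?_
    contrapose! hHF
    obtain ⟨x, -, -, -, h⟩ := exists_erase_eq_of_incidence_mul_incidence_ne_zero hHF
    exact h

variable (k : Type v) [Field k]

theorem boundaryMap_comp_boundaryMap (hA : (A : Set (Finset V)).OrdConnected) (n : ℕ) :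
    boundaryMap k A n ∘ₗ boundaryMap k A (n + 1) = 0 := by
  rw [boundaryMap, boundaryMap, ← Matrix.mulVecLin_mul]
  refine (congrArg Matrix.mulVecLin ?_).trans Matrix.mulVecLin_zero
  ext H F
  have h := congrArg (Int.cast : ℤ → k) (sum_incidence_mul_incidence hA F.2 H.2)
  rw [← sum_coe_sort] at h
  push_cast at h
  simpa only [Matrix.mul_apply, Matrix.of_apply, Matrix.zero_apply, mul_comm] using h

theorem range_boundaryMap_le_cycles (hA : (A : Set (Finset V)).OrdConnected) :
    ∀ n, LinearMap.range (boundaryMap k A n) ≤ cycles k A n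
  | 0 => le_top
  | n + 1 => LinearMap.range_le_ker_iff.2 (boundaryMap_comp_boundaryMap k hA n)

theorem finrank_chains (A : Finset (Finset V)) (n : ℕ) :
    Module.finrank k (facesOfCard A n → k) = #(facesOfCard A n) := by
  rw [Module.finrank_fintype_fun_eq_card, Fintype.card_coe]

theorem finrank_homology_add_card (hA : (A : Set (Finset V)).OrdConnected) (n : ℕ) :
    Module.finrank k (Homology k A n) + #(facesOfCard A (n + 1)) =
      Module.finrank k (cycles k A n) + Module.finrank k (cycles k A (n + 1)) := by
  have cycles_eq : Module.finrank k (Homology k A n) +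
      Module.finrank k (LinearMap.range (boundaryMap k A n)) = Module.finrank k (cycles k A n) := by
    rw [← Submodule.finrank_quotient_add_finrank
      ((LinearMap.range (boundaryMap k A n)).submoduleOf (cycles k A n)),
      (Submodule.submoduleOfEquivOfLe (range_boundaryMap_le_cycles k hA n)).finrank_eq]
  have rank_nullity := (LinearMap.finrank_range_add_finrank_ker (boundaryMap k A n)).trans
    (finrank_chains k A (n + 1))
  rw [← cycles_eq, ← rank_nullity, add_assoc]
  rfl

/-- The sum of `(-1) ^ #F` over the faces `F` in `A`. It is the negative of the usual reduced Euler
characteristic, since `F` has dimension `#F - 1`. -/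
def eulerChar (A : Finset (Finset V)) : ℤ := ∑ F ∈ A, (-1) ^ #F

theorem eulerChar_eq_sum_card_facesOfCard {N : ℕ} (hN : ∀ F ∈ A, #F < N) :
    eulerChar A = ∑ n ∈ range N, (-1) ^ n * (#(facesOfCard A n) : ℤ) := by
  rw [eulerChar, ← sum_fiberwise_of_maps_to' fun F hF => mem_range.2 (hN F hF)]
  simp only [sum_const, nsmul_eq_mul, facesOfCard, mul_comm]

theorem sum_finrank_homology (hA : (A : Set (Finset V)).OrdConnected) (N : ℕ) :
    ∑ n ∈ range N, (-1) ^ n * (Module.finrank k (Homology k A n) : ℤ) =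
      ∑ n ∈ range N, (-1) ^ n * (#(facesOfCard A n) : ℤ) +
        (-1) ^ N * (#(facesOfCard A N) - Module.finrank k (cycles k A N) : ℤ) := by
  induction N with
  | zero =>
    have cycles_zero : Module.finrank k (cycles k A 0) = #(facesOfCard A 0) :=
      (finrank_top k _).trans (finrank_chains k A 0)
    simp [cycles_zero]
  | succ N ih =>
    have h : (Module.finrank k (Homology k A N) + #(facesOfCard A (N + 1)) : ℤ) =
        Module.finrank k (cycles k A N) + Module.finrank k (cycles k A (N + 1)) :=
      mod_cast finrank_homology_add_card k hA N
    rw [sum_range_succ, sum_range_succ, ih, pow_succ]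
    linear_combination (-1) ^ N * h

theorem eulerChar_eq_sum_finrank_homology (hA : (A : Set (Finset V)).OrdConnected) {N : ℕ}
    (hN : ∀ F ∈ A, #F < N) :
    eulerChar A = ∑ n ∈ range N, (-1) ^ n * (Module.finrank k (Homology k A n) : ℤ) := by
  have chains_eq_zero : #(facesOfCard A N) = 0 :=
    Finset.card_eq_zero.2 (filter_eq_empty_iff.2 fun F hF => (hN F hF).ne)
  have cycles_eq_zero : Module.finrank k (cycles k A N) = 0 := by
    have := (Submodule.finrank_le (cycles k A N)).trans_eq (finrank_chains k A N)
    omega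
  rw [sum_finrank_homology k hA, eulerChar_eq_sum_card_facesOfCard hN, chains_eq_zero,
    cycles_eq_zero]
  simp

variable {k}

theorem IsAcyclic.eulerChar_eq_zero (h : IsAcyclic k A) (hA : (A : Set (Finset V)).OrdConnected) :
    eulerChar A = 0 := by
  rw [eulerChar_eq_sum_finrank_homology k hA fun F hF => Nat.lt_succ_of_le (le_sup (f := card) hF)]
  exact sum_eq_zero fun n _ => by rw [h n, Nat.cast_zero, mul_zero]

theorem HasSphereHomology.eulerChar_eq {s : ℕ} (h : HasSphereHomology k A s)
    (hA : (A : Set (Finset V)).OrdConnected) : eulerChar A = (-1) ^ s := by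
  have hN : ∀ F ∈ A, #F < A.sup card + s + 1 := fun F hF => by
    have := le_sup (f := card) hF
    omega
  rw [eulerChar_eq_sum_finrank_homology k hA hN,
    sum_eq_single_of_mem s (mem_range.2 (by omega)) fun n _ hn => by rw [h n, if_neg hn]; simp,
    h s, if_pos rfl, Nat.cast_one, mul_one]

end EulerPoincare

namespace FinComplex

variable {V : Type u} {d : ℕ} {k : Type v} [Field k]

theorem mem_openStar {K : FinComplex V} {F G : Finset V} :
    G ∈ K.openStar F ↔ G ∈ K.faces ∧ F ⊆ G := by
  classical
  exact mem_filter

theorem openStar_empty (K : FinComplex V) : K.openStar ∅ = K.faces := by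
  ext G
  simp [mem_openStar]

theorem openStar_eq_empty {K : FinComplex V} {F : Finset V} (hF : F ∉ K.faces) :
    K.openStar F = ∅ :=
  eq_empty_of_forall_notMem fun G hG =>
    hF (K.down_closed G (mem_openStar.1 hG).1 F (mem_openStar.1 hG).2)

open scoped Classical in
theorem eulerChar_openStar (K : FinComplex V) (F : Finset V) :
    eulerChar (K.openStar F) = ∑ G ∈ K.faces, if F ⊆ G then (-1) ^ #G else 0 := by
  rw [eulerChar, openStar, sum_filter]

theorem ordConnected_openStar (K : FinComplex V) (F : Finset V) :
    (K.openStar F : Set (Finset V)).OrdConnected := by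
  refine ⟨fun G hG H hH I hI => mem_coe.2 (mem_openStar.2 ?_)⟩
  rw [mem_coe, mem_openStar] at hG hH
  exact ⟨K.down_closed H hH.1 I hI.2, hG.2.trans hI.1⟩

theorem sum_mul_eulerChar_openStar (K : FinComplex V) (f : Finset V → ℤ) :
    ∑ F ∈ K.faces, f F * eulerChar (K.openStar F) =
      ∑ G ∈ K.faces, (-1) ^ #G * ∑ F ∈ G.powerset, f F := by
  simp only [eulerChar, mul_comm (f _), sum_mul, mul_sum]
  refine sum_comm' fun F G => ?_
  rw [mem_openStar, mem_powerset]
  exact ⟨fun h => ⟨h.2.2, h.2.1⟩, fun h => ⟨K.down_closed G h.2 F h.1, h.2, h.1⟩⟩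

theorem mem_boundaryFaces {K : FinComplex V} {F : Finset V} :
    F ∈ K.boundaryFaces k ↔ F ∈ K.faces ∧ (F = ∅ ∨ IsAcyclic k (K.openStar F)) := by
  classical
  exact mem_filter

/-- `K` is an Eulerian `(d-1)`-sphere: every open star has the Euler characteristic of an open star
in a triangulation of the `(d-1)`-sphere. The case of the empty face says that `K` itself has the
Euler characteristic of this sphere. -/
def IsEulerianSphere (K : FinComplex V) (d : ℕ) : Prop :=
  ∀ F ∈ K.faces, eulerChar (K.openStar F) = (-1) ^ d

end FinComplex

section FlagNumbers

variable {V : Type u} {d : ℕ} {A : Finset (Finset V)} {κ : V → Fin d}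

theorem eulerChar_image_subset (hκ : ∀ F ∈ A, Set.InjOn κ F) (T : Finset (Fin d)) :
    eulerChar {F ∈ A | F.image κ ⊆ T} = (-1) ^ #T * flagH A κ T := by
  have signed_flagF : ∀ S ∈ T.powerset,
      ∑ F ∈ {F ∈ A | F.image κ ⊆ T} with F.image κ = S, (-1 : ℤ) ^ #F =
        (-1) ^ #S * flagF A κ S := by
    intro S hS
    rw [filter_filter, filter_congr (q := (image κ · = S)) fun F _ =>
        ⟨And.right, fun h => ⟨h ▸ mem_powerset.1 hS, h⟩⟩,
      flagF, mul_comm, ← nsmul_eq_mul, ← sum_const]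
    refine sum_congr rfl fun F hF => ?_
    rw [← (mem_filter.1 hF).2, card_image_of_injOn (hκ F (mem_filter.1 hF).1)]
  rw [eulerChar, ← sum_fiberwise_of_maps_to (f := fun F => (-1 : ℤ) ^ #F)
    fun F hF => mem_powerset.2 (mem_filter.1 hF).2, sum_congr rfl signed_flagF, flagH, mul_sum]
  refine sum_congr rfl fun S hS => ?_
  obtain ⟨m, hm⟩ := Nat.exists_eq_add_of_le (card_le_card (mem_powerset.1 hS))
  have sign_sq : (-1 : ℤ) ^ m * (-1) ^ m = 1 := pow_mul_pow_eq_one m (by norm_num)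
  rw [hm, Nat.add_sub_cancel_left, pow_add]
  linear_combination -(-1 : ℤ) ^ #S * flagF A κ S * sign_sq

theorem sum_flagH_singleton (hA : ∅ ∈ A) (hκ : ∀ F ∈ A, Set.InjOn κ F) :
    ∑ c, flagH A κ {c} = #(facesOfCard A 1) - d := by
  have flagF_empty : flagF A κ ∅ = 1 := by
    rw [flagF, card_eq_one]
    refine ⟨∅, ?_⟩
    ext F
    simp only [image_eq_empty, mem_filter, mem_singleton]
    exact ⟨And.right, fun h => ⟨h ▸ hA, h⟩⟩
  have flagH_singleton : ∀ c, flagH A κ {c} = flagF A κ {c} - 1 := by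
    intro c
    have powerset_singleton : ({c} : Finset (Fin d)).powerset = {∅, {c}} := rfl
    rw [flagH, powerset_singleton, sum_pair (singleton_ne_empty c).symm, flagF_empty]
    simp only [card_singleton, card_empty]
    ring
  have sum_flagF : ∑ c, flagF A κ {c} = #(facesOfCard A 1) := by
    classical
    unfold flagF
    rw [← card_biUnion]
    · congr 1
      ext F
      simp only [mem_biUnion, mem_univ, true_and, mem_filter, mem_facesOfCard, exists_and_left]
      refine and_congr_right fun hF => ?_
      rw [← card_eq_one, card_image_of_injOn (hκ F hF)]
    · intro c _ c' _ hcc'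
      exact disjoint_filter.2 fun F _ h h' => hcc' (singleton_injective (h.symm.trans h'))
  simp [flagH_singleton, ← sum_flagF]

theorem flagF_map {W : Type*} {n : ℕ} (e : V ↪ W) (ι : Fin d ↪ Fin n) {κ' : W → Fin n}
    (hκ : ∀ x, κ' (e x) = ι (κ x)) (S : Finset (Fin d)) :
    flagF (A.map (mapEmbedding e).toEmbedding) κ' (S.map ι) = flagF A κ S := by
  have image_map : ∀ F : Finset V, (F.map e).image κ' = (F.image κ).map ι := by
    intro F
    ext c
    simp [hκ]
  rw [flagF, filter_map, card_map, flagF]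
  congr 1
  refine filter_congr fun F _ => ?_
  simp [image_map]

theorem flagH_map {W : Type*} {n : ℕ} (e : V ↪ W) (ι : Fin d ↪ Fin n) {κ' : W → Fin n}
    (hκ : ∀ x, κ' (e x) = ι (κ x)) (T : Finset (Fin d)) :
    flagH (A.map (mapEmbedding e).toEmbedding) κ' (T.map ι) = flagH A κ T := by
  have powerset_map : (T.map ι).powerset = T.powerset.map (mapEmbedding ι).toEmbedding := by
    simp only [map_eq_image, powerset_image]
    exact image_congr fun S _ => (map_eq_image ι S).symm
  rw [flagH, flagH, powerset_map, sum_map]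
  refine sum_congr rfl fun S _ => ?_
  rw [RelEmbedding.coe_toEmbedding, mapEmbedding_apply, card_map, card_map, flagF_map e ι hκ]

theorem sum_powerset_image_subset_compl (κ : V → Fin d) (T : Finset (Fin d)) (G : Finset V) :
    ∑ F ∈ G.powerset, (if F.image κ ⊆ Tᶜ then (-1 : ℤ) ^ #F else 0) =
      if G.image κ ⊆ T then 1 else 0 := by
  classical
  have powerset_filter : {F ∈ G.powerset | F.image κ ⊆ Tᶜ} = {x ∈ G | κ x ∈ Tᶜ}.powerset := by
    ext F
    simp only [mem_filter, mem_powerset, image_subset_iff]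
    exact ⟨fun h x hx => mem_filter.2 ⟨h.1 hx, h.2 x hx⟩,
      fun h => ⟨h.trans (filter_subset _ _), fun x hx => (mem_filter.1 (h hx)).2⟩⟩
  rw [← sum_filter, powerset_filter, sum_powerset_neg_one_pow_card]
  simp [filter_eq_empty_iff, image_subset_iff]

theorem FinComplex.sum_neg_one_pow_mul_sum_powerset (K : FinComplex V) (κ : V → Fin d)
    (T : Finset (Fin d)) :
    ∑ G ∈ K.faces, (-1) ^ #G *
        ∑ F ∈ G.powerset, (if F.image κ ⊆ Tᶜ then (-1 : ℤ) ^ #F else 0) =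
      eulerChar {G ∈ K.faces | G.image κ ⊆ T} := by
  simp only [sum_powerset_image_subset_compl, mul_ite, mul_one, mul_zero]
  rw [← sum_filter, eulerChar]

theorem neg_one_pow_mul_neg_one_pow_card_compl (T : Finset (Fin d)) :
    (-1 : ℤ) ^ d * (-1) ^ #Tᶜ = (-1) ^ #T := by
  have card_add : d + #Tᶜ = #T + 2 * #Tᶜ := by
    have := (card_compl_add_card T).trans (Fintype.card_fin d)
    omega
  rw [← pow_add, card_add, pow_add, pow_mul, neg_one_sq, one_pow, mul_one]

/-- These are the Dehn–Sommerville relations for balanced complexes. -/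
theorem FinComplex.IsEulerianSphere.flagH_compl {K : FinComplex V} (hK : K.IsEulerianSphere d)
    (hκ : ∀ F ∈ K.faces, Set.InjOn κ F) (T : Finset (Fin d)) :
    flagH K.faces κ Tᶜ = flagH K.faces κ T := by
  have duality : eulerChar {F ∈ K.faces | F.image κ ⊆ T} =
      (-1) ^ d * eulerChar {F ∈ K.faces | F.image κ ⊆ Tᶜ} := by
    rw [← K.sum_neg_one_pow_mul_sum_powerset κ T, ← K.sum_mul_eulerChar_openStar, eulerChar,
      sum_filter, mul_sum]
    exact sum_congr rfl fun F hF => by rw [hK F hF, mul_comm]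
  rw [eulerChar_image_subset hκ, eulerChar_image_subset hκ, ← mul_assoc,
    neg_one_pow_mul_neg_one_pow_card_compl] at duality
  exact (mul_left_cancel₀ (pow_ne_zero _ (by norm_num)) duality).symm

end FlagNumbers

theorem sum_powerset_neg_one_pow_card_of_subset {α : Type*} [DecidableEq α] (F G : Finset α) :
    ∑ H ∈ G.powerset, (if F ⊆ H then (-1 : ℤ) ^ #H else 0) = if F = G then (-1) ^ #F else 0 := by
  rw [← sum_filter]
  by_cases hFG : F ⊆ G
  · have filter_eq : {H ∈ G.powerset | F ⊆ H} = (G \ F).powerset.image (F ∪ ·) := by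
      rw [← Icc_eq_image_powerset hFG]
      ext H
      simp [and_comm]
    have disjoint_of_mem : ∀ H ∈ (G \ F).powerset, Disjoint F H := fun H hH =>
      disjoint_sdiff.mono_right (mem_powerset.1 hH)
    have sum_union : ∀ H ∈ (G \ F).powerset, (-1 : ℤ) ^ #(F ∪ H) = (-1) ^ #F * (-1) ^ #H :=
      fun H hH => by rw [card_union_of_disjoint (disjoint_of_mem H hH), pow_add]
    have union_injOn : Set.InjOn (F ∪ ·) ((G \ F).powerset : Set (Finset α)) := by
      intro H hH H' hH' h
      rw [← union_sdiff_cancel_left (disjoint_of_mem H hH),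
        ← union_sdiff_cancel_left (disjoint_of_mem H' hH')]
      exact congrArg (· \ F) h
    rw [filter_eq, sum_image union_injOn, sum_congr rfl sum_union, ← mul_sum,
      sum_powerset_neg_one_pow_card, mul_ite, mul_one, mul_zero]
    exact if_congr (sdiff_eq_empty_iff_subset.trans
      ⟨fun h => hFG.antisymm h, fun h => h.superset⟩) rfl rfl
  · rw [if_neg fun h => hFG h.subset, sum_eq_zero]
    intro H hH
    exact absurd ((mem_filter.1 hH).2.trans (mem_powerset.1 (mem_filter.1 hH).1)) hFG

section CrossPolytope

variable {V : Type u} {d : ℕ} (φ : Fin d × Bool ↪ V)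

/-- The face of the cross-polytope with vertices `φ (i, b)` that contains `φ (i, b)` if and only if
`g i = some b`; thus `g` chooses at most one vertex of each antipodal pair. -/
def crossFace (g : Fin d → Option Bool) : Finset V :=
  ({p | g p.1 = some p.2} : Finset (Fin d × Bool)).map φ

theorem apply_mem_crossFace {g : Fin d → Option Bool} {p : Fin d × Bool} :
    φ p ∈ crossFace φ g ↔ g p.1 = some p.2 := by
  simp [crossFace]

theorem crossFace_subset_iff {g : Fin d → Option Bool} {F : Finset V} :
    crossFace φ g ⊆ F ↔ ∀ i b, g i = some b → φ (i, b) ∈ F := by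
  simp only [crossFace, subset_iff, mem_map, mem_filter, mem_univ, true_and]
  exact ⟨fun h i b hi => h ⟨(i, b), hi, rfl⟩, fun h _ ⟨p, hp, hx⟩ => hx ▸ h p.1 p.2 hp⟩

theorem crossFace_injective : Function.Injective (crossFace φ) := fun g g' h => by
  funext i
  ext b
  rw [← apply_mem_crossFace φ (p := (i, b)), h, apply_mem_crossFace]

theorem neg_one_pow_card_crossFace (g : Fin d → Option Bool) :
    (-1 : ℤ) ^ #(crossFace φ g) = ∏ i, if g i = none then 1 else -1 := by
  rw [crossFace, card_map, ← prod_const, prod_filter, Fintype.prod_prod_type]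
  refine prod_congr rfl fun i _ => ?_
  rcases h : g i with _ | _ | _ <;> simp [h]

theorem sum_crossFace (p : Fin d → Option Bool → Prop) [∀ i, DecidablePred (p i)] :
    ∑ g : Fin d → Option Bool with ∀ i, p i (g i), (-1 : ℤ) ^ #(crossFace φ g) =
      ∏ i, ∑ o : Option Bool with p i o, if o = none then 1 else -1 := by
  have filter_eq_piFinset : ({g | ∀ i, p i (g i)} : Finset (Fin d → Option Bool)) =
      Fintype.piFinset fun i => {o : Option Bool | p i o} := by
    ext g
    simp
  simp only [neg_one_pow_card_crossFace, filter_eq_piFinset]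
  exact (prod_univ_sum (fun i => {o : Option Bool | p i o}) fun _ o =>
    if o = none then (1 : ℤ) else -1).symm

namespace FinComplex.IsCrossPolytope

variable {C : FinComplex V}

theorem exists_faces_eq_map_crossFace (hC : C.IsCrossPolytope d) :
    ∃ φ : Fin d × Bool ↪ V, C.faces = univ.map ⟨crossFace φ, crossFace_injective φ⟩ := by
  classical
  obtain ⟨φ, hφ⟩ := hC
  refine ⟨φ, ?_⟩
  ext F
  rw [hφ, mem_map]
  constructor
  · rintro ⟨G, hG, rfl⟩
    refine ⟨fun i => if (i, true) ∈ G then some true else if (i, false) ∈ G then some false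
      else none, mem_univ _, congrArg (map φ) ?_⟩
    ext ⟨i, b⟩
    have := hG i
    cases b <;> grind
  · rintro ⟨g, -, rfl⟩
    exact ⟨_, fun i => by grind, rfl⟩

theorem isEulerianSphere (hC : C.IsCrossPolytope d) : C.IsEulerianSphere d := by
  classical
  obtain ⟨φ, hφ⟩ := hC.exists_faces_eq_map_crossFace
  intro F hF
  rw [hφ] at hF
  obtain ⟨g, -, rfl⟩ := mem_map.1 hF
  have openStar_eq : C.openStar (crossFace φ g) =
      ({g' | ∀ i, g i = none ∨ g' i = g i} : Finset _).map
        ⟨crossFace φ, crossFace_injective φ⟩ := by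
    ext G
    simp only [mem_openStar, hφ, mem_map, mem_filter, mem_univ, true_and,
      Function.Embedding.coeFn_mk]
    constructor
    · rintro ⟨⟨g', rfl⟩, h⟩
      simp only [crossFace_subset_iff, apply_mem_crossFace] at h
      refine ⟨g', fun i => ?_, rfl⟩
      cases hi : g i with
      | none => exact Or.inl rfl
      | some b => exact Or.inr (h i b hi)
    · rintro ⟨g', h, rfl⟩
      refine ⟨⟨g', rfl⟩, (crossFace_subset_iff φ).2 fun i b hi => (apply_mem_crossFace φ).2 ?_⟩
      grind
  have local_sum : ∀ i, ∑ o with g i = none ∨ o = g i, (if o = none then (1 : ℤ) else -1) = -1 := by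
    intro i
    rcases g i with _ | _ | _ <;> decide
  rw [eulerChar, Function.Embedding.coeFn_mk, openStar_eq, sum_map]
  simp only [Function.Embedding.coeFn_mk]
  rw [sum_crossFace φ fun i o => g i = none ∨ o = g i, prod_congr rfl fun i _ => local_sum i,
    prod_const, card_fin]

theorem card_facesOfCard_one (hC : C.IsCrossPolytope d) : #(facesOfCard C.faces 1) = 2 * d := by
  obtain ⟨φ, hφ⟩ := hC
  have faces_eq : facesOfCard C.faces 1 = univ.map (φ.trans ⟨singleton, singleton_injective⟩) := by
    ext F
    simp only [mem_facesOfCard, mem_map, mem_univ, true_and, card_eq_one]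
    constructor
    · rintro ⟨hF, x, rfl⟩
      obtain ⟨G, -, hG⟩ := (hφ _).1 hF
      obtain ⟨p, -, hp⟩ := mem_map.1 (hG ▸ mem_singleton_self x)
      exact ⟨p, congrArg singleton hp⟩
    · rintro ⟨p, rfl⟩
      exact ⟨(hφ _).2 ⟨{p}, fun i => by grind, map_singleton φ p⟩, φ p, rfl⟩
  rw [faces_eq, card_map, card_univ, Fintype.card_prod, Fintype.card_bool, Fintype.card_fin,
    mul_comm]

theorem exists_bijective_color {κ : V → Fin d} (hκ : ∀ F ∈ C.faces, Set.InjOn κ F)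
    (hφ : C.faces = univ.map ⟨crossFace φ, crossFace_injective φ⟩) :
    ∃ σ : Fin d → Fin d, σ.Bijective ∧ ∀ i b, κ (φ (i, b)) = σ i := by
  have injective_color : ∀ ε : Fin d → Bool, Function.Injective fun i => κ (φ (i, ε i)) := by
    intro ε i j hij
    have facet_mem : crossFace φ (fun i => some (ε i)) ∈ C.faces := by
      rw [hφ]
      exact mem_map.2 ⟨fun i => some (ε i), mem_univ _, rfl⟩
    have vertex_mem : ∀ i, φ (i, ε i) ∈ crossFace φ fun i => some (ε i) := fun i =>
      (apply_mem_crossFace φ).2 rfl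
    exact congrArg Prod.fst (φ.injective (hκ _ facet_mem (vertex_mem i) (vertex_mem j) hij))
  have bijective_true := Finite.injective_iff_bijective.1 (injective_color fun _ => true)
  refine ⟨_, bijective_true, fun i b => ?_⟩
  obtain ⟨j, hj⟩ := bijective_true.2 (κ (φ (i, b)))
  have hij : j = i := by
    by_contra hij
    refine hij (injective_color (Function.update (fun _ => true) i b) ?_)
    simpa [Function.update_of_ne hij] using hj
  exact hij ▸ hj.symm

theorem flagH_eq_one (hC : C.IsCrossPolytope d) {κ : V → Fin d}
    (hκ : ∀ F ∈ C.faces, Set.InjOn κ F) (T : Finset (Fin d)) : flagH C.faces κ T = 1 := by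
  obtain ⟨φ, hφ⟩ := hC.exists_faces_eq_map_crossFace
  obtain ⟨σ, hσ, hσκ⟩ := exists_bijective_color φ hκ hφ
  have mem_iff : ∀ g : Fin d → Option Bool,
      (crossFace φ g).image κ ⊆ T ↔ ∀ i, g i = none ∨ σ i ∈ T := by
    intro g
    rw [image_subset_iff]
    constructor
    · intro h i
      cases hi : g i with
      | none => exact Or.inl rfl
      | some b => exact Or.inr (hσκ i b ▸ h _ ((apply_mem_crossFace φ).2 hi))
    · intro h x hx
      obtain ⟨⟨i, b⟩, -, rfl⟩ := mem_map.1 hx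
      rw [apply_mem_crossFace] at hx
      exact hσκ i b ▸ (h i).resolve_left (by simp [hx])
  have local_sum : ∀ i, ∑ o : Option Bool with o = none ∨ σ i ∈ T,
      (if o = none then (1 : ℤ) else -1) = if σ i ∈ T then -1 else 1 := by
    intro i
    by_cases hi : σ i ∈ T
    · simp only [hi, or_true, if_true]
      decide
    · simp only [hi, or_false, if_false]
      decide
  have eulerChar_eq : eulerChar {F ∈ C.faces | F.image κ ⊆ T} = (-1) ^ #T := by
    rw [eulerChar, hφ, filter_map, sum_map]
    simp only [Function.Embedding.coeFn_mk, Function.comp_def, mem_iff]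
    rw [sum_crossFace φ fun i o => o = none ∨ σ i ∈ T, prod_congr rfl fun i _ => local_sum i,
      hσ.prod_comp fun c => if c ∈ T then (-1 : ℤ) else 1, prod_ite_mem, univ_inter, prod_const]
  rw [eulerChar_image_subset hκ] at eulerChar_eq
  exact mul_left_cancel₀ (pow_ne_zero _ (by norm_num)) (eulerChar_eq.trans (mul_one _).symm)

end FinComplex.IsCrossPolytope

end CrossPolytope

namespace CrossPolytopalComplex

variable {V : Type u} {d : ℕ} (X : CrossPolytopalComplex V d)

theorem card_oldFace (F : Finset V) : #(X.oldFace F) = #F := card_map _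

theorem card_coneFace (C : X.cells) (F : Finset V) : #(X.coneFace C F) = #F + 1 := by
  rw [coneFace, card_cons, card_oldFace]

variable {X}

theorem oldFace_subset_oldFace {F G : Finset V} : X.oldFace F ⊆ X.oldFace G ↔ F ⊆ G :=
  map_subset_map

theorem oldFace_subset_coneFace {C : X.cells} {F G : Finset V} :
    X.oldFace F ⊆ X.coneFace C G ↔ F ⊆ G := by
  simp [oldFace, coneFace, subset_iff]

theorem coneFace_subset_coneFace {C C' : X.cells} {F G : Finset V} :
    X.coneFace C F ⊆ X.coneFace C' G ↔ C = C' ∧ F ⊆ G := by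
  simp [oldFace, coneFace, subset_iff]

theorem not_coneFace_subset_oldFace {C : X.cells} {F G : Finset V} :
    ¬X.coneFace C F ⊆ X.oldFace G := by
  simp [oldFace, coneFace, subset_iff]

theorem oldFace_eq_empty {F : Finset V} : X.oldFace F = ∅ ↔ F = ∅ := map_eq_empty

theorem mem_stellar {G : Finset (V ⊕ X.cells)} :
    G ∈ X.stellar.faces ↔ (∃ F ∈ X.skel.faces, X.oldFace F = G) ∨
      ∃ C : X.cells, ∃ F ∈ C.1.faces, X.coneFace C F = G := by
  simp [stellar]

theorem oldFace_mem_stellar {F : Finset V} (hF : F ∈ X.skel.faces) :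
    X.oldFace F ∈ X.stellar.faces :=
  mem_stellar.2 (Or.inl ⟨F, hF, rfl⟩)

theorem mem_boundaryFaces {k : Type v} [Field k] {F : Finset V} :
    F ∈ X.boundaryFaces k ↔
      F ∈ X.skel.faces ∧ (F = ∅ ∨ IsAcyclic k (X.stellar.openStar (X.oldFace F))) := by
  classical
  exact mem_filter

variable (X)

theorem sum_stellar (f : Finset (V ⊕ X.cells) → ℤ) :
    ∑ G ∈ X.stellar.faces, f G = ∑ F ∈ X.skel.faces, f (X.oldFace F) +
      ∑ C : X.cells, ∑ F ∈ C.1.faces, f (X.coneFace C F) := by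
  classical
  have coneFace_injective : ∀ C, Function.Injective (X.coneFace C) := fun C F G h =>
    (coneFace_subset_coneFace.1 h.subset).2.antisymm (coneFace_subset_coneFace.1 h.symm.subset).2
  have oldFace_injective : Function.Injective X.oldFace := map_injective _
  rw [stellar, sum_union, sum_image oldFace_injective.injOn, sum_biUnion]
  · exact congrArg _ (sum_congr rfl fun C _ => sum_image (coneFace_injective C).injOn)
  · intro C _ C' _ hCC'
    refine disjoint_left.2 fun G hG hG' => ?_
    obtain ⟨F, -, rfl⟩ := mem_image.1 hG
    obtain ⟨F', -, h⟩ := mem_image.1 hG'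
    exact hCC' (coneFace_subset_coneFace.1 h.symm.subset).1
  · refine disjoint_left.2 fun G hG hG' => ?_
    obtain ⟨F, -, rfl⟩ := mem_image.1 hG
    obtain ⟨C, -, hC⟩ := mem_biUnion.1 hG'
    obtain ⟨F', -, h⟩ := mem_image.1 hC
    exact not_coneFace_subset_oldFace h.subset

theorem eulerChar_openStar_oldFace (F : Finset V) :
    eulerChar (X.stellar.openStar (X.oldFace F)) =
      eulerChar (X.skel.openStar F) - ∑ C ∈ X.cells, eulerChar (C.openStar F) := by
  classical
  simp only [FinComplex.eulerChar_openStar, X.sum_stellar, oldFace_subset_oldFace,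
    oldFace_subset_coneFace, card_oldFace, card_coneFace]
  rw [sub_eq_add_neg, ← sum_coe_sort X.cells, ← sum_neg_distrib]
  simp only [← sum_neg_distrib, pow_succ, mul_neg_one, neg_zero, apply_ite Neg.neg]

theorem eulerChar_openStar_coneFace (C : X.cells) (F : Finset V) :
    eulerChar (X.stellar.openStar (X.coneFace C F)) = -eulerChar (C.1.openStar F) := by
  classical
  simp only [FinComplex.eulerChar_openStar, X.sum_stellar, not_coneFace_subset_oldFace, if_false,
    sum_const_zero, zero_add, coneFace_subset_coneFace, card_coneFace]
  rw [sum_eq_single_of_mem C (mem_univ C) fun C' _ h => sum_eq_zero fun G _ =>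
    if_neg fun h' => h h'.1.symm, ← sum_neg_distrib]
  refine sum_congr rfl fun G _ => ?_
  simp only [true_and, pow_succ, mul_neg_one, apply_ite Neg.neg, neg_zero]

section Boundary

variable (k : Type v) [Field k]

theorem boundaryFaces_stellar :
    X.stellar.boundaryFaces k =
      (X.boundaryFaces k).map (mapEmbedding Function.Embedding.inl).toEmbedding := by
  ext G
  simp only [FinComplex.mem_boundaryFaces, mem_map, mem_boundaryFaces]
  constructor
  · rintro ⟨hG, hG_boundary⟩
    rcases mem_stellar.1 hG with ⟨F, hF, rfl⟩ | ⟨C, F, hF, rfl⟩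
    · exact ⟨F, ⟨hF, hG_boundary.imp_left oldFace_eq_empty.1⟩, rfl⟩
    · rcases hG_boundary with h | h
      · exact absurd h (cons_ne_empty _)
      · have eulerChar_eq_zero := h.eulerChar_eq_zero (X.stellar.ordConnected_openStar _)
        rw [X.eulerChar_openStar_coneFace,
          (X.cell_crossPolytope C.1 C.2).isEulerianSphere F hF] at eulerChar_eq_zero
        simp at eulerChar_eq_zero
  · rintro ⟨F, ⟨hF, hF_boundary⟩, rfl⟩
    exact ⟨oldFace_mem_stellar hF, hF_boundary.imp_left oldFace_eq_empty.2⟩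

theorem flagH_boundaryFaces_stellar (κ : V → Fin d) (T : Finset (Fin d)) :
    flagH (X.stellar.boundaryFaces k) (X.stellarColoring κ) (T.map Fin.castSuccEmb) =
      flagH (X.boundaryFaces k) κ T := by
  rw [boundaryFaces_stellar]
  exact flagH_map Function.Embedding.inl Fin.castSuccEmb (fun _ => rfl) T

end Boundary

/-- `X` is an Eulerian `d`-ball with boundary complex `Δ`: the open stars in the triangulation
`X.stellar` of `X` have the Euler characteristics of the open stars in a triangulated `d`-ball with
boundary `Δ`. Nothing is required of the cone faces, since the cells are cross-polytopes. -/
structure IsEulerianBall (Δ : FinComplex V) : Prop where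
  subset_skel : Δ.faces ⊆ X.skel.faces
  eulerChar_of_mem : ∀ F ∈ Δ.faces, eulerChar (X.stellar.openStar (X.oldFace F)) = 0
  eulerChar_of_notMem : ∀ F ∈ X.skel.faces, F ∉ Δ.faces →
    eulerChar (X.stellar.openStar (X.oldFace F)) = (-1) ^ (d + 1)

variable {X} {Δ : FinComplex V}

theorem IsHomologyBall.isEulerianBall {k : Type v} [Field k] (hX : X.IsHomologyBall k)
    (hΔ : X.boundaryFaces k = Δ.faces) : X.IsEulerianBall Δ := by
  refine ⟨fun F hF => (mem_boundaryFaces.1 (hΔ ▸ hF)).1, fun F hF => ?_, fun F hF hFΔ => ?_⟩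
  · rw [← hΔ, mem_boundaryFaces] at hF
    rcases hF.2 with rfl | h
    · refine IsAcyclic.eulerChar_eq_zero (k := k) ?_ (X.stellar.ordConnected_openStar _)
      rw [oldFace_eq_empty.2 rfl, FinComplex.openStar_empty]
      exact hX.2.1
    · exact h.eulerChar_eq_zero (X.stellar.ordConnected_openStar _)
  · rw [← hΔ, mem_boundaryFaces, not_and, not_or] at hFΔ
    obtain ⟨hF_ne, hF_not_acyclic⟩ := hFΔ hF
    have sphere := (hX.1.1 _ (oldFace_mem_stellar hF) (oldFace_eq_empty.not.2 hF_ne)).resolve_left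
      hF_not_acyclic
    exact sphere.eulerChar_eq (X.stellar.ordConnected_openStar _)

namespace IsEulerianBall

/-- The left-hand side sums `f F` times the Euler characteristic of the open star of `F` in the
skeleton, which is a sum of contributions of the cells containing `F` and of `X.stellar`. -/
theorem sum_neg_one_pow_mul_sum_powerset (hX : X.IsEulerianBall Δ) (f : Finset V → ℤ) :
    ∑ G ∈ X.skel.faces, (-1) ^ #G * ∑ F ∈ G.powerset, f F =
      (-1) ^ d * (∑ C ∈ X.cells, ∑ F ∈ C.faces, f F -
        (∑ F ∈ X.skel.faces, f F - ∑ F ∈ Δ.faces, f F)) := by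
  classical
  have sum_cell : ∀ C ∈ X.cells, ∑ F ∈ X.skel.faces, f F * eulerChar (C.openStar F) =
      (-1) ^ d * ∑ F ∈ C.faces, f F := by
    intro C hC
    rw [← sum_subset (X.cell_subset C hC) fun F _ hF => by
      rw [FinComplex.openStar_eq_empty hF, eulerChar, sum_empty, mul_zero], mul_sum]
    refine sum_congr rfl fun F hF => ?_
    rw [(X.cell_crossPolytope C hC).isEulerianSphere F hF, mul_comm]
  have sum_stellar : ∑ F ∈ X.skel.faces, f F * eulerChar (X.stellar.openStar (X.oldFace F)) =
      -(-1) ^ d * (∑ F ∈ X.skel.faces, f F - ∑ F ∈ Δ.faces, f F) := by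
    rw [← sum_sdiff hX.subset_skel, ← sum_sdiff hX.subset_skel, add_sub_cancel_right,
      sum_eq_zero (s := Δ.faces) fun F hF => by rw [hX.eulerChar_of_mem F hF, mul_zero],
      add_zero, mul_sum]
    refine sum_congr rfl fun F hF => ?_
    rw [hX.eulerChar_of_notMem F (mem_sdiff.1 hF).1 (mem_sdiff.1 hF).2]
    ring
  have eulerChar_skel : ∀ F, eulerChar (X.skel.openStar F) =
      ∑ C ∈ X.cells, eulerChar (C.openStar F) +
        eulerChar (X.stellar.openStar (X.oldFace F)) := fun F => by
    rw [X.eulerChar_openStar_oldFace, add_sub_cancel]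
  simp only [← X.skel.sum_mul_eulerChar_openStar, eulerChar_skel, mul_add, sum_add_distrib,
    sum_stellar]
  simp only [mul_sum (s := X.cells)]
  rw [sum_comm, sum_congr rfl sum_cell, ← mul_sum]
  ring

theorem sum_neg_one_pow_mul_sum_powerset_of_support (hX : X.IsEulerianBall Δ) {f : Finset V → ℤ}
    (hf : ∀ F ∈ X.skel.faces, F ∉ Δ.faces → f F = 0) :
    ∑ G ∈ X.skel.faces, (-1) ^ #G * ∑ F ∈ G.powerset, f F =
      (-1) ^ d * ∑ C ∈ X.cells, ∑ F ∈ C.faces, f F := by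
  rw [hX.sum_neg_one_pow_mul_sum_powerset, sum_subset hX.subset_skel hf, sub_self, sub_zero]

theorem flagH_eq_card_cells_of_injOn_skel (hX : X.IsEulerianBall Δ) {κ : V → Fin d}
    (hκ : ∀ F ∈ X.skel.faces, Set.InjOn κ F) {s : ℕ}
    (hs : ∀ F ∈ X.skel.faces, #F ≤ s → F ∈ Δ.faces) {T : Finset (Fin d)} (hT : #T ≤ s)
    (hTc : d ≤ s + #T) : flagH Δ.faces κ T = #X.cells := by
  have mem_boundary : ∀ S : Finset (Fin d), #S ≤ s → ∀ F ∈ X.skel.faces, F.image κ ⊆ S →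
      F ∈ Δ.faces := fun S hS F hF hFS =>
    hs F hF ((card_image_of_injOn (hκ F hF) ▸ card_le_card hFS).trans hS)
  have hTc' : #Tᶜ ≤ s := by
    rw [card_compl, Fintype.card_fin]
    omega
  have boundary_eq : {G ∈ X.skel.faces | G.image κ ⊆ T} = {G ∈ Δ.faces | G.image κ ⊆ T} := by
    ext G
    simp only [mem_filter, and_congr_left_iff]
    exact fun hG => ⟨fun h => mem_boundary T hT G h hG, fun h => hX.subset_skel h⟩
  have cell_eq : ∀ C ∈ X.cells,
      ∑ F ∈ C.faces, (if F.image κ ⊆ Tᶜ then (-1 : ℤ) ^ #F else 0) = (-1) ^ #Tᶜ := by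
    intro C hC
    have hκC : ∀ F ∈ C.faces, Set.InjOn κ F := fun F hF => hκ F (X.cell_subset C hC hF)
    rw [← sum_filter, ← eulerChar, eulerChar_image_subset hκC,
      (X.cell_crossPolytope C hC).flagH_eq_one hκC, mul_one]
  have key := hX.sum_neg_one_pow_mul_sum_powerset_of_support
    (f := fun F => if F.image κ ⊆ Tᶜ then (-1) ^ #F else 0) fun F hF hFΔ =>
      if_neg fun h => hFΔ (mem_boundary Tᶜ hTc' F hF h)
  rw [X.skel.sum_neg_one_pow_mul_sum_powerset, boundary_eq,
    eulerChar_image_subset fun F hF => hκ F (hX.subset_skel hF), sum_congr rfl cell_eq, sum_const,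
    nsmul_eq_mul, mul_left_comm, neg_one_pow_mul_neg_one_pow_card_compl, mul_comm] at key
  exact mul_right_cancel₀ (pow_ne_zero _ (by norm_num)) key

theorem isEulerianSphere_boundary (hX : X.IsEulerianBall Δ) : Δ.IsEulerianSphere d := by
  classical
  intro F hF
  have key := hX.sum_neg_one_pow_mul_sum_powerset fun H => if F ⊆ H then (-1) ^ #H else 0
  simp only [sum_powerset_neg_one_pow_card_of_subset, ← FinComplex.eulerChar_openStar, mul_ite,
    mul_zero, sum_ite_eq, if_pos (hX.subset_skel hF)] at key
  have star_eq := hX.eulerChar_of_mem F hF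
  rw [X.eulerChar_openStar_oldFace] at star_eq
  have sign_sq (n : ℕ) : (-1 : ℤ) ^ n * (-1) ^ n = 1 := pow_mul_pow_eq_one n (by norm_num)
  rw [sign_sq, ← sub_add, ← neg_sub (eulerChar _), star_eq, neg_zero, zero_add] at key
  linear_combination -(-1) ^ d * key - eulerChar (Δ.openStar F) * sign_sq d

section Polygon

variable {X : CrossPolytopalComplex V 2}

theorem card_facesOfCard_one_eq (hX : X.IsEulerianBall Δ)
    (hs : ∀ F ∈ X.skel.faces, #F ≤ 1 → F ∈ Δ.faces) :
    (#(facesOfCard Δ.faces 1) : ℤ) = 2 * #X.cells + 2 := by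
  -- On faces with at most two vertices this weight is fixed by the transform on the left-hand side
  -- of `sum_neg_one_pow_mul_sum_powerset`.
  let w : ℕ → ℤ := fun n => (if n = 0 then 2 else 0) - if n = 1 then 1 else 0
  have transform_w : ∀ G ∈ X.skel.faces, (-1) ^ #G * ∑ F ∈ G.powerset, w #F = w #G := by
    intro G hG
    have card_le := X.skel_dim G hG
    rw [sum_powerset_apply_card]
    interval_cases #G <;> simp [w, sum_range_succ]
  have sum_w : ∀ K : FinComplex V, ∑ F ∈ K.faces, w #F = 2 - #(facesOfCard K.faces 1) := by
    intro K
    have sum_card_zero : ∑ F ∈ K.faces, (if #F = 0 then (2 : ℤ) else 0) = 2 := by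
      rw [sum_eq_single_of_mem ∅ K.empty_mem fun F _ hF => if_neg (card_ne_zero.2
        (nonempty_iff_ne_empty.2 hF)), if_pos card_empty]
    simp [w, sum_sub_distrib, facesOfCard, sum_card_zero]
  have skel_eq : facesOfCard X.skel.faces 1 = facesOfCard Δ.faces 1 := by
    ext F
    simp only [mem_facesOfCard, and_congr_left_iff]
    exact fun hF => ⟨fun h => hs F h hF.le, fun h => hX.subset_skel h⟩
  have cell_eq : ∀ C ∈ X.cells, ∑ F ∈ C.faces, w #F = -2 := fun C hC => by
    rw [sum_w, (X.cell_crossPolytope C hC).card_facesOfCard_one]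
    norm_num
  have key := hX.sum_neg_one_pow_mul_sum_powerset_of_support (f := fun F => w #F)
    fun F hF hFΔ => by
      have one_lt_card : 1 < #F := not_le.1 fun h => hFΔ (hs F hF h)
      simp only [w, one_lt_card.ne', (zero_lt_one.trans one_lt_card).ne', if_false, sub_zero]
  rw [sum_congr rfl transform_w, sum_w, skel_eq, sum_congr rfl cell_eq, sum_const,
    nsmul_eq_mul] at key
  linarith

theorem flagH_eq_card_cells_of_polygon (hX : X.IsEulerianBall Δ) {κ : V → Fin 2}
    (hκ : ∀ F ∈ Δ.faces, Set.InjOn κ F) (hs : ∀ F ∈ X.skel.faces, #F ≤ 1 → F ∈ Δ.faces)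
    {T : Finset (Fin 2)} (hT : #T = 1) : flagH Δ.faces κ T = #X.cells := by
  have flagH_eq : flagH Δ.faces κ {1} = flagH Δ.faces κ {0} :=
    hX.isEulerianSphere_boundary.flagH_compl hκ {0}
  have sum_flagH := sum_flagH_singleton Δ.empty_mem hκ
  rw [Fin.sum_univ_two, flagH_eq, hX.card_facesOfCard_one_eq hs] at sum_flagH
  have flagH_zero : flagH Δ.faces κ {0} = #X.cells := by
    push_cast at sum_flagH
    linarith
  obtain ⟨c, rfl⟩ := card_eq_one.1 hT
  fin_cases c
  exacts [flagH_zero, flagH_eq.trans flagH_zero]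

end Polygon

theorem injOn_skel {κ : V → Fin d} (hκ : ∀ F ∈ Δ.faces, Set.InjOn κ F) {s : ℕ}
    (hs : ∀ F ∈ X.skel.faces, #F ≤ s → F ∈ Δ.faces) (h : 2 ≤ s ∨ d ≤ 1) :
    ∀ F ∈ X.skel.faces, Set.InjOn κ F := by
  classical
  intro F hF x hx y hy hxy
  rcases h with h | h
  · have pair_mem : ({x, y} : Finset V) ∈ Δ.faces :=
      hs _ (X.skel.down_closed F hF _ (insert_subset hx (singleton_subset_iff.2 hy)))
        (card_le_two.trans h)
    exact hκ _ pair_mem (mem_coe.2 (mem_insert_self x {y}))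
      (mem_coe.2 (mem_insert_of_mem (mem_singleton_self y))) hxy
  · exact card_le_one.1 ((X.skel_dim F hF).trans h) x hx y hy

end IsEulerianBall

end CrossPolytopalComplex

theorem theorem5p7_general {V : Type u} {d s : ℕ} {Δ : FinComplex V} {κ : V → Fin d}
    (hκ : ∀ F ∈ Δ.faces, Set.InjOn κ F) {X : CrossPolytopalComplex V d} (hX : X.IsEulerianBall Δ)
    (hs : ∀ F ∈ X.skel.faces, #F ≤ s → F ∈ Δ.faces) {T : Finset (Fin d)} (hT : #T ≤ s)
    (hTc : d ≤ s + #T) : flagH Δ.faces κ T = #X.cells := by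
  by_cases h : 2 ≤ s ∨ d ≤ 1
  · exact hX.flagH_eq_card_cells_of_injOn_skel
      (CrossPolytopalComplex.IsEulerianBall.injOn_skel hκ hs h) hs hT hTc
  · obtain rfl : d = 2 := by omega
    obtain rfl : s = 1 := by omega
    exact hX.flagH_eq_card_cells_of_polygon hκ hs (by omega)

theorem theorem5p7 {k : Type v} [Field k] {V : Type u} (d r : ℕ) (hr : 1 ≤ r) (hrd : r ≤ d)
    (Δ : FinComplex V) (κ : V → Fin d) (hbal : Δ.IsBalanced κ) (hsph : Δ.IsHomologySphere k d)
    (X : CrossPolytopalComplex V d) (hX : X.IsStackedDecomposition k Δ r)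
    (T : Finset (Fin d)) (hT₁ : r - 1 ≤ #T) (hT₂ : #T ≤ d - r + 1) :
    flagH Δ.faces κ T =
        flagH (X.stellar.boundaryFaces k) (X.stellarColoring κ) (T.map Fin.castSuccEmb) ∧
      flagH (X.stellar.boundaryFaces k) (X.stellarColoring κ) (T.map Fin.castSuccEmb) =
        (#X.cells : ℤ) := by
  have boundary_eq : flagH (X.stellar.boundaryFaces k) (X.stellarColoring κ)
      (T.map Fin.castSuccEmb) = flagH Δ.faces κ T := by
    rw [X.flagH_boundaryFaces_stellar, hX.2.1]
  have flagH_eq : flagH Δ.faces κ T = #X.cells :=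
    theorem5p7_general hbal.2 (hX.1.isEulerianBall hX.2.1) hX.2.2 hT₂ (by omega)
  exact ⟨boundary_eq.symm, boundary_eq.trans flagH_eq⟩
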